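/- Let $G$ be a finite group (with the discrete topology) or a compact Lie group. Let $\mathcal H$ and $\mathcal K$ be finite-dimensional complex Hilbert spaces (possibly equal) carrying continuous unitary representations $U$ and $V$ of $G$ respectively. A quantum operation from $\mathcal B(\mathcal H)$ to $\mathcal B(\mathcal K)$ is a completely positive trace-preserving linear map $\mathcal E$; it is $G$-covariant if $\mathcal E(U(g)XU(g)^\dagger)=V(g)\mathcal E(X)V(g)^\dagger$ for all $g\in G$ and all $X\in\mathcal B(\mathcal H)$, and $G$-covariance of operations from $\mathcal B(\mathcal K)$ to $\mathcal B(\mathcal H)$ is defined in the same way. Unit vectors $|\psi\rangle\in\mathcal H$ and $|\phi\rangle\in\mathcal K$ are called $G$-equivalent if there are a $G$-covariant quantum operation $\mathcal E$ from $\mathcal B(\mathcal H)$ to $\mathcal B(\mathcal K)$ with $\mathcal E(|\psi\rangle\langle\psi|)=|\phi\rangle\langle\phi|$ and a $G$-covariant quantum operation $\mathcal F$ from $\mathcal B(\mathcal K)$ to $\mathcal B(\mathcal H)$ with $\mathcal F(|\phi\rangle\langle\phi|)=|\psi\rangle\langle\psi|$. Suppose that the characteristic functions $\chi_\psi(g)=\langle\psi|U(g)|\psi\rangle$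 and $\chi_\phi(g)=\langle\phi|V(g)|\phi\rangle$ are nonzero for every $g\in G$. Then $|\psi\rangle$ and $|\phi\rangle$ are $G$-equivalent if and only if there is a one-dimensional unitary representation of $G$, that is, a continuous homomorphism $e^{i\Theta}$ from $G$ to the unit circle, such that $$\forall g\in G:\quad \langle\psi|U(g)|\psi\rangle = e^{i\Theta(g)}\,\langle\phi|V(g)|\phi\rangle .$$ -/

import Mathlib

open scoped ContDiff Manifold

/-- `G` is a finite group (with its discrete topology) or a compact real Lie group. -/
def IsFiniteOrCompactLieGroup (G : Type*) [Group G] [TopologicalSpace G] : Prop :=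
  (Finite G ∧ DiscreteTopology G) ∨
    (CompactSpace G ∧ T2Space G ∧
      ∃ (n : ℕ) (_ : ChartedSpace (EuclideanSpace ℝ (Fin n)) G), LieGroup (𝓡 n) ∞ G)

/-- A unitary representation of `G` on the (finite-dimensional) Hilbert space `H`: a continuous
homomorphism into the unitary group of `H`. For a discrete group continuity is automatic. -/
abbrev UnitaryRep (G H : Type*) [Group G] [TopologicalSpace G] [NormedAddCommGroup H]
    [InnerProductSpace ℂ H] [CompleteSpace H] : Type _ :=
  G →ₜ* unitary (H →L[ℂ] H)

/-- The characteristic function `χ_ψ(g) = ⟨ψ|U(g)|ψ⟩`; `inner` is linear in its second argument. -/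
noncomputable def charFn {G H : Type*} [Group G] [TopologicalSpace G] [NormedAddCommGroup H]
    [InnerProductSpace ℂ H] [CompleteSpace H] (U : UnitaryRep G H) (ψ : H) (g : G) : ℂ :=
  inner ℂ ψ ((U g : H →L[ℂ] H) ψ)

/-- The density operator `|ψ⟩⟨ψ|` of the pure state given by the unit vector `ψ`. -/
noncomputable def pureState {H : Type*} [NormedAddCommGroup H] [InnerProductSpace ℂ H] (ψ : H) :
    H →L[ℂ] H :=
  InnerProductSpace.rankOne ℂ ψ ψ

/-- The action `𝒰(g)[X] = U(g) X U(g)†` of the symmetry group on operators. -/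
noncomputable def UnitaryRep.conj {G H : Type*} [Group G] [TopologicalSpace G]
    [NormedAddCommGroup H] [InnerProductSpace ℂ H] [CompleteSpace H] (U : UnitaryRep G H) (g : G)
    (X : H →L[ℂ] H) : H →L[ℂ] H :=
  (U g : H →L[ℂ] H) * X * star (U g : H →L[ℂ] H)

/-- A quantum operation: a completely positive, trace-preserving linear map between the operator
algebras of two finite-dimensional Hilbert spaces. -/
structure QuantumOperation (H K : Type*) [NormedAddCommGroup H] [InnerProductSpace ℂ H]
    [CompleteSpace H] [FiniteDimensional ℂ H] [NormedAddCommGroup K] [InnerProductSpace ℂ K]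
    [CompleteSpace K] [FiniteDimensional ℂ K] extends
    CompletelyPositiveMap (H →L[ℂ] H) (K →L[ℂ] K) where
  trace_preserving (X : H →L[ℂ] H) :
    LinearMap.trace ℂ K (toLinearMap X : K →ₗ[ℂ] K) = LinearMap.trace ℂ H (X : H →ₗ[ℂ] H)

section Covariance

variable {G H K : Type*} [Group G] [TopologicalSpace G]
  [NormedAddCommGroup H] [InnerProductSpace ℂ H] [CompleteSpace H] [FiniteDimensional ℂ H]
  [NormedAddCommGroup K] [InnerProductSpace ℂ K] [CompleteSpace K] [FiniteDimensional ℂ K]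

/-- `E` is `G`-covariant with respect to the representations `U` on its input space and `V` on its
output space. -/
def QuantumOperation.IsCovariant (E : QuantumOperation H K) (U : UnitaryRep G H)
    (V : UnitaryRep G K) : Prop :=
  ∀ (g : G) (X : H →L[ℂ] H), E.toLinearMap (U.conj g X) = V.conj g (E.toLinearMap X)

/-- The state `ρ` can be transformed into the state `σ` by a `G`-covariant quantum operation. -/
def CovConvertible (U : UnitaryRep G H) (V : UnitaryRep G K) (ρ : H →L[ℂ] H) (σ : K →L[ℂ] K) :
    Prop :=
  ∃ E : QuantumOperation H K, E.IsCovariant U V ∧ E.toLinearMap ρ = σ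

/-- `G`-equivalence: `ρ` and `σ` are reversibly interconvertible by `G`-covariant operations. -/
def GEquivalent (U : UnitaryRep G H) (V : UnitaryRep G K) (ρ : H →L[ℂ] H) (σ : K →L[ℂ] K) :
    Prop :=
  CovConvertible U V ρ σ ∧ CovConvertible V U σ ρ

end Covariance

open InnerProductSpace ContinuousLinearMap

/-! Necessity: a covariant operation taking `ψ` to `φ` takes each orbit state of `U g ψ` to that of
`V g φ`. Complete positivity on finitely many orbit points then writes the Gram matrix of `ψ`'s
orbit as that of `φ`'s times, entrywise, another Gram matrix
(`QuantumOperation.exists_gram_factor`), so `f = χ_ψ / χ_φ` is of positive type with `f 1 = 1`.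
Hence `|f| ≤ 1`, and the reverse conversion gives `|f| = 1`. Unit vectors with unimodular inner
product are parallel, which makes `f` multiplicative.

Sufficiency: after twisting by the phase, both orbits have the same Gram matrix, so a partial
isometry `W` carries one to the other and intertwines the representations up to the phase. Sending
the complement of its initial space to the maximally mixed state, which is invariant, completes `W`
to a covariant operation. -/

theorem exists_eq_star_mul_self_of_nonneg {A : Type*} [NonUnitalCStarAlgebra A] [PartialOrder A]
    [StarOrderedRing A] {a : A} (ha : 0 ≤ a) : ∃ b, a = star b * b :=
  CStarAlgebra.nonneg_iff_eq_star_mul_self.mp ha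

theorem CStarMatrix.sum_apply {ι m n A : Type*} [AddCommMonoid A] (s : Finset ι)
    (M : ι → CStarMatrix m n A) (i : m) (j : n) : (∑ r ∈ s, M r) i j = ∑ r ∈ s, M r i j := by
  classical
  induction s using Finset.induction_on with
  | empty => simp
  | insert a s ha ih => rw [Finset.sum_insert ha, Finset.sum_insert ha, CStarMatrix.add_apply, ih]

/-! ### Positive operator matrices and Gram matrices. -/

section Operators

variable {H K : Type*} [NormedAddCommGroup H] [InnerProductSpace ℂ H] [CompleteSpace H]
  [NormedAddCommGroup K] [InnerProductSpace ℂ K] [CompleteSpace K]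

/-- The matrix is `star R * R`, where the only nonzero row of `R` has entries `|u⟩⟨v j|` with `u` a
unit vector; this needs a nonempty index type and `K ≠ 0`. -/
theorem CStarMatrix.ofMatrix_rankOne_nonneg {n : Type*} [Fintype n] (v : n → K) :
    0 ≤ CStarMatrix.ofMatrix (Matrix.of fun i j => rankOne ℂ (v i) (v j)) := by
  classical
  rcases isEmpty_or_nonempty n with hn | ⟨⟨i₀⟩⟩
  · exact le_of_eq (CStarMatrix.ext fun i => hn.elim i)
  rcases subsingleton_or_nontrivial K with hK | hK
  · exact le_of_eq (CStarMatrix.ext fun i j => Subsingleton.elim _ _)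
  obtain ⟨u, hu⟩ := exists_norm_eq K zero_le_one
  let R : CStarMatrix n n (K →L[ℂ] K) := CStarMatrix.ofMatrix
    (Matrix.of fun i j => if i = i₀ then rankOne ℂ u (v j) else 0)
  have : CStarMatrix.ofMatrix (Matrix.of fun i j => rankOne ℂ (v i) (v j)) = star R * R := by
    ext1 i j
    rw [CStarMatrix.mul_apply, Finset.sum_eq_single i₀]
    · simp only [R, CStarMatrix.star_apply, CStarMatrix.ofMatrix_apply, Matrix.of_apply, if_true]
      rw [star_eq_adjoint, adjoint_rankOne, mul_def, rankOne_comp_rankOne]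
      simp [inner_self_eq_norm_sq_to_K, hu]
    · intro r _ hr
      simp [R, CStarMatrix.star_apply, CStarMatrix.ofMatrix_apply, hr]
    · simp
  rw [this]
  exact star_mul_self_nonneg R

/-- Inserting `∑ |b l⟩⟨b l| = 1` between the two factors reduces this to the rank-one case. -/
theorem CStarMatrix.ofMatrix_adjoint_comp_nonneg [FiniteDimensional ℂ H] {n : Type*} [Fintype n]
    (T : n → K →L[ℂ] H) :
    0 ≤ CStarMatrix.ofMatrix (Matrix.of fun i j => adjoint (T i) ∘L T j) := by
  let b := stdOrthonormalBasis ℂ H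
  have : CStarMatrix.ofMatrix (Matrix.of fun i j => adjoint (T i) ∘L T j) =
      ∑ l, CStarMatrix.ofMatrix (Matrix.of fun i j =>
        rankOne ℂ (adjoint (T i) (b l)) (adjoint (T j) (b l))) := by
    ext1 i j
    rw [CStarMatrix.sum_apply]
    simp only [CStarMatrix.ofMatrix_apply, Matrix.of_apply]
    ext x
    simp only [_root_.sum_apply, rankOne_apply, adjoint_inner_left, comp_apply]
    conv_lhs => rw [← b.sum_repr' (T j x)]
    simp
  rw [this]
  exact Finset.sum_nonneg fun l _ => ofMatrix_rankOne_nonneg _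

/-- A map `X ↦ L† X L` is completely positive. -/
theorem CStarMatrix.map_conj_nonneg [FiniteDimensional ℂ H] {n : Type*} [Fintype n] (L : K →L[ℂ] H)
    {M : CStarMatrix n n (H →L[ℂ] H)} (hM : 0 ≤ M) :
    0 ≤ M.map (fun X => adjoint L ∘L X ∘L L) := by
  obtain ⟨B, rfl⟩ := exists_eq_star_mul_self_of_nonneg hM
  have : (star B * B).map (fun X => adjoint L ∘L X ∘L L) =
      ∑ r, CStarMatrix.ofMatrix (Matrix.of fun i j => adjoint (B r i ∘L L) ∘L (B r j ∘L L)) := by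
    ext1 i j
    rw [CStarMatrix.sum_apply, CStarMatrix.map_apply, CStarMatrix.mul_apply]
    simp only [CStarMatrix.ofMatrix_apply, Matrix.of_apply, CStarMatrix.star_apply,
      star_eq_adjoint, adjoint_comp]
    ext x
    simp [map_sum]
  rw [this]
  exact Finset.sum_nonneg fun r _ => ofMatrix_adjoint_comp_nonneg _

/-- Two families of vectors with the same Gram matrix are related by a partial isometry whose
initial space is the span of the first family. -/
theorem exists_partialIsometry_of_inner_eq [FiniteDimensional ℂ H] {ι : Type*} (v : ι → H)
    (w : ι → K) (h : ∀ i j, inner ℂ (v i) (v j) = inner ℂ (w i) (w j)) :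
    ∃ W : H →L[ℂ] K, (∀ i, W (v i) = w i) ∧
      adjoint W ∘L W = (Submodule.span ℂ (Set.range v)).starProjection := by
  let A := Finsupp.linearCombination ℂ v
  let B := Finsupp.linearCombination ℂ w
  have hAB : ∀ a b, inner ℂ (A a) (A b) = inner ℂ (B a) (B b) := by
    intro a b
    simp only [A, B, Finsupp.linearCombination_apply, Finsupp.sum, sum_inner, inner_sum,
      inner_smul_left, inner_smul_right, h]
  -- Linear relations among the `v i` also hold among the `w i`, so `B` composed with any section
  -- `s` of `A` does not depend on `s`.
  have hker : ∀ a, A a = 0 → B a = 0 := by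
    intro a ha
    rw [← inner_self_eq_zero (𝕜 := ℂ), ← hAB, ha, inner_zero_left]
  rw [← Finsupp.range_linearCombination]
  obtain ⟨s, hs⟩ := A.rangeRestrict.exists_rightInverse_of_surjective A.range_rangeRestrict
  have hs' : ∀ x : A.range, A (s x) = x := fun x =>
    congrArg Subtype.val (LinearMap.congr_fun hs x)
  let C : A.range →L[ℂ] K := (B ∘ₗ s).toContinuousLinearMap
  have hC : ∀ x y : A.range, inner ℂ (C x) (C y) = inner ℂ (x : H) (y : H) := by
    intro x y
    simp [C, ← hAB, hs']
  refine ⟨C ∘L A.range.orthogonalProjectionOnto, fun i => ?_, ?_⟩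
  · have hv : A (Finsupp.single i 1) = v i := by simp [A]
    have hw : B (Finsupp.single i 1) = w i := by simp [B]
    have hmem : v i ∈ A.range := hv ▸ LinearMap.mem_range_self A _
    have hp : A.range.orthogonalProjectionOnto (v i) = ⟨v i, hmem⟩ :=
      A.range.orthogonalProjectionOnto_mem_subspace_eq_self ⟨v i, hmem⟩
    rw [comp_apply, hp, ← hw]
    refine sub_eq_zero.1 ((map_sub B _ _).symm.trans (hker _ ?_))
    rw [map_sub, hs', hv, sub_self]
  · ext x
    refine ext_inner_left ℂ fun y => ?_
    rw [comp_apply, adjoint_inner_right, comp_apply, comp_apply, hC]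
    change inner ℂ (A.range.starProjection y) (A.range.starProjection x) = _
    rw [Submodule.inner_starProjection_left_eq_right,
      Submodule.starProjection_eq_self_iff.2 (Submodule.starProjection_apply_mem _ _)]

end Operators

theorem eq_rankOne_of_apply_eq_zero {K : Type*} [NormedAddCommGroup K]
    [InnerProductSpace ℂ K] {T : K →L[ℂ] K} {w : K} (hw : ‖w‖ = 1)
    (h : ∀ x, inner ℂ w x = 0 → T x = 0) : T = rankOne ℂ (T w) w := by
  ext x
  have h1 := h (x - inner ℂ w x • w) (by
    rw [inner_sub_right, inner_smul_right, inner_self_eq_norm_sq_to_K, hw]; simp)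
  rw [map_sub, map_smul, sub_eq_zero] at h1
  rw [h1, rankOne_apply]

theorem trace_comp_comm {H K : Type*} [NormedAddCommGroup H] [InnerProductSpace ℂ H]
    [FiniteDimensional ℂ H] [NormedAddCommGroup K] [InnerProductSpace ℂ K] [FiniteDimensional ℂ K]
    (S : H →L[ℂ] K) (T : K →L[ℂ] H) :
    LinearMap.trace ℂ K (S ∘L T : K →ₗ[ℂ] K) = LinearMap.trace ℂ H (T ∘L S : H →ₗ[ℂ] H) := by
  rw [toLinearMap_comp, toLinearMap_comp, LinearMap.trace_comp_comm']

/-- Equality in Cauchy–Schwarz gives `y = r • x` with `|r| = 1`, and the two phases cancel. -/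
theorem inner_mul_inner_of_norm_inner_eq_one {F : Type*} [NormedAddCommGroup F]
    [InnerProductSpace ℂ F] {x y : F} (hx : ‖x‖ = 1) (hy : ‖y‖ = 1) (hxy : ‖inner ℂ x y‖ = 1)
    (z : F) : inner ℂ y x * inner ℂ z y = inner ℂ z x := by
  obtain ⟨r, -, rfl⟩ := (norm_inner_eq_norm_iff (𝕜 := ℂ) (x := x) (y := y)
    (norm_ne_zero_iff.1 (by rw [hx]; exact one_ne_zero))
    (norm_ne_zero_iff.1 (by rw [hy]; exact one_ne_zero))).1 (by rw [hxy, hx, hy, one_mul])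
  have hr : ‖r‖ = 1 := by rwa [norm_smul, hx, mul_one] at hy
  rw [inner_smul_left, inner_smul_right, inner_self_eq_norm_sq_to_K, hx, mul_assoc, ← mul_assoc _ r]
  have : (starRingEnd ℂ) r * r = 1 := by rw [Complex.conj_mul', hr]; simp
  simp only [map_one, one_pow, one_mul]
  rw [← mul_assoc, this, one_mul]

/-! ### Orbits and characteristic functions of a unitary representation. -/

section Representation

variable {G H : Type*} [Group G] [TopologicalSpace G] [NormedAddCommGroup H]
  [InnerProductSpace ℂ H] [CompleteSpace H]

theorem inner_rep_apply (U : UnitaryRep G H) (ψ : H) (g h : G) :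
    inner ℂ ((U g : H →L[ℂ] H) ψ) ((U h : H →L[ℂ] H) ψ) = charFn U ψ (g⁻¹ * h) := by
  rw [charFn, map_mul, map_inv, ← adjoint_inner_right]
  rfl

theorem rep_mul_apply (U : UnitaryRep G H) (g h : G) (x : H) :
    (U (g * h) : H →L[ℂ] H) x = (U g : H →L[ℂ] H) ((U h : H →L[ℂ] H) x) := by
  rw [map_mul]; rfl

theorem rep_one_apply (U : UnitaryRep G H) (x : H) : (U 1 : H →L[ℂ] H) x = x := by
  rw [map_one]; rfl

theorem norm_rep_apply (U : UnitaryRep G H) (g : G) (x : H) : ‖(U g : H →L[ℂ] H) x‖ = ‖x‖ :=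
  Unitary.norm_map (U g) x

theorem conj_pureState (U : UnitaryRep G H) (g : G) (ψ : H) :
    U.conj g (pureState ψ) = pureState ((U g : H →L[ℂ] H) ψ) := by
  rw [UnitaryRep.conj, pureState, pureState, star_eq_adjoint, mul_def, mul_def, comp_rankOne,
    rankOne_comp, adjoint_adjoint]

theorem charFn_one (U : UnitaryRep G H) {ψ : H} (hψ : ‖ψ‖ = 1) : charFn U ψ 1 = 1 := by
  rw [charFn, rep_one_apply, inner_self_eq_norm_sq_to_K, hψ]; simp

theorem continuous_charFn (U : UnitaryRep G H) (ψ : H) : Continuous (charFn U ψ) := by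
  unfold charFn
  have : Continuous fun g => (U g : H →L[ℂ] H) := continuous_subtype_val.comp U.continuous_toFun
  fun_prop

end Representation

/-! ### Sufficiency: covariant operations from a phase. -/

section Conversion

variable {G H K : Type*} [Group G] [TopologicalSpace G]
  [NormedAddCommGroup H] [InnerProductSpace ℂ H] [CompleteSpace H]
  [NormedAddCommGroup K] [InnerProductSpace ℂ K] [CompleteSpace K]

/-- The operation `X ↦ W X W† + tr(Q X Q) 1 / dim K`, which is trace preserving when
`W†W + Q†Q = 1`. -/
noncomputable def partialIsometryMap (W : H →L[ℂ] K) (Q : H →L[ℂ] H) :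
    (H →L[ℂ] H) →ₗ[ℂ] (K →L[ℂ] K) where
  toFun X := W ∘L X ∘L adjoint W +
    ((Module.finrank ℂ K : ℂ)⁻¹ * LinearMap.trace ℂ H (Q ∘L X ∘L Q : H →ₗ[ℂ] H)) • 1
  map_add' X Y := by
    simp only [comp_add, add_comp, toLinearMap_add, map_add, mul_add, add_smul]
    abel
  map_smul' c X := by
    simp only [comp_smul, smul_comp, toLinearMap_smul, map_smul, smul_eq_mul, smul_add, smul_smul,
      RingHom.id_apply]
    congr 2
    ring

theorem partialIsometryMap_apply (W : H →L[ℂ] K) (Q X : H →L[ℂ] H) :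
    partialIsometryMap W Q X = W ∘L X ∘L adjoint W +
      ((Module.finrank ℂ K : ℂ)⁻¹ * LinearMap.trace ℂ H (Q ∘L X ∘L Q : H →ₗ[ℂ] H)) • 1 := rfl

variable [FiniteDimensional ℂ H] [FiniteDimensional ℂ K]

/-- This is a Kraus decomposition: expanding the trace in `e` and the identity in `f` turns the
second term into a sum of conjugations by `c |Q e l⟩⟨f m|`. -/
theorem partialIsometryMap_map_nonneg (W : H →L[ℂ] K) {Q : H →L[ℂ] H} (hQ : adjoint Q = Q)
    {n : Type*} [Fintype n] (M : CStarMatrix n n (H →L[ℂ] H)) (hM : 0 ≤ M) :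
    0 ≤ M.map (partialIsometryMap W Q) := by
  let e := stdOrthonormalBasis ℂ H
  let f := stdOrthonormalBasis ℂ K
  let c : ℂ := ((√(Module.finrank ℂ K : ℝ))⁻¹ : ℝ)
  -- For `K = 0` both sides are `0`, by the convention for inverses.
  have hc : c * c = (Module.finrank ℂ K : ℂ)⁻¹ := by
    simp only [c]
    rw [← Complex.ofReal_mul, ← mul_inv, Real.mul_self_sqrt (Nat.cast_nonneg _)]
    simp
  have hc' : (starRingEnd ℂ) c = c := Complex.conj_ofReal _
  have : M.map (partialIsometryMap W Q) =
      M.map (fun X => adjoint (adjoint W) ∘L X ∘L adjoint W) +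
        ∑ l, ∑ m, M.map (fun X => adjoint (c • rankOne ℂ (Q (e l)) (f m)) ∘L X ∘L
          (c • rankOne ℂ (Q (e l)) (f m))) := by
    ext1 i j
    simp only [CStarMatrix.add_apply, CStarMatrix.sum_apply, CStarMatrix.map_apply,
      partialIsometryMap_apply, adjoint_adjoint]
    congr 1
    rw [LinearMap.trace_eq_sum_inner _ e, ← hc, Finset.mul_sum, Finset.sum_smul]
    refine Finset.sum_congr rfl fun l _ => ?_
    have h1 : (1 : K →L[ℂ] K) = ∑ m, rankOne ℂ (f m) (f m) := f.sum_rankOne_eq_id.symm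
    rw [h1, Finset.smul_sum]
    refine Finset.sum_congr rfl fun m _ => ?_
    ext x
    have h2 : inner ℂ (e l) (Q (M i j (Q (e l)))) = inner ℂ (Q (e l)) (M i j (Q (e l))) := by
      rw [← adjoint_inner_left, hQ]
    simp only [map_smulₛₗ, adjoint_rankOne, h2, hc', smul_apply, rankOne_apply, comp_apply,
      coe_coe, RingHom.id_apply, smul_smul]
    congr 1
    ring
  rw [this]
  exact add_nonneg (CStarMatrix.map_conj_nonneg _ hM) (Finset.sum_nonneg fun l _ =>
    Finset.sum_nonneg fun m _ => CStarMatrix.map_conj_nonneg _ hM)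

theorem trace_partialIsometryMap [Nontrivial K] {W : H →L[ℂ] K} {Q : H →L[ℂ] H}
    (hWQ : adjoint W ∘L W + Q ∘L Q = 1) (X : H →L[ℂ] H) :
    LinearMap.trace ℂ K (partialIsometryMap W Q X : K →ₗ[ℂ] K) =
      LinearMap.trace ℂ H (X : H →ₗ[ℂ] H) := by
  have hd : (Module.finrank ℂ K : ℂ) ≠ 0 := by
    exact_mod_cast Module.finrank_pos.ne'
  have h1 : LinearMap.trace ℂ K ((1 : K →L[ℂ] K) : K →ₗ[ℂ] K) = Module.finrank ℂ K :=
    LinearMap.trace_one ℂ K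
  rw [partialIsometryMap_apply, toLinearMap_add, toLinearMap_smul, map_add, map_smul, h1,
    smul_eq_mul, mul_right_comm, inv_mul_cancel₀ hd, one_mul, trace_comp_comm W,
    trace_comp_comm Q, ← map_add, ← toLinearMap_add, comp_assoc, comp_assoc, ← comp_add, hWQ]
  rfl

/-- A partial isometry that intertwines two unitary representations up to phases can be completed
to a covariant quantum operation. -/
theorem covConvertible_of_partialIsometry [Nontrivial K] (U : UnitaryRep G H) (V : UnitaryRep G K)
    (W : H →L[ℂ] K) (hW : IsIdempotentElem (adjoint W ∘L W)) (ξ : G → Circle)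
    (hξ : ∀ g, W ∘L (U g : H →L[ℂ] H) = (ξ g : ℂ) • ((V g : K →L[ℂ] K) ∘L W))
    {ψ : H} (hψ : adjoint W (W ψ) = ψ) :
    CovConvertible U V (pureState ψ) (pureState (W ψ)) := by
  set Q : H →L[ℂ] H := 1 - adjoint W ∘L W with hQdef
  have hQadj : adjoint Q = Q := by
    rw [hQdef, map_sub, adjoint_comp, adjoint_adjoint]
    congr 1
    exact star_one (H →L[ℂ] H)
  have hQQ : Q ∘L Q = Q := hW.one_sub.eq
  have hWQ : adjoint W ∘L W + Q ∘L Q = 1 := by rw [hQQ, hQdef]; abel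
  have hUU : ∀ g, adjoint (U g : H →L[ℂ] H) ∘L (U g : H →L[ℂ] H) = 1 := fun g =>
    Unitary.star_mul_self_of_mem (U g).2
  have hUU' : ∀ g, (U g : H →L[ℂ] H) ∘L adjoint (U g : H →L[ℂ] H) = 1 := fun g =>
    Unitary.mul_star_self_of_mem (U g).2
  have hVV : ∀ g, adjoint (V g : K →L[ℂ] K) ∘L (V g : K →L[ℂ] K) = 1 := fun g =>
    Unitary.star_mul_self_of_mem (V g).2
  have hVV' : ∀ g, (V g : K →L[ℂ] K) ∘L adjoint (V g : K →L[ℂ] K) = 1 := fun g =>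
    Unitary.mul_star_self_of_mem (V g).2
  have hξξ : ∀ g, (starRingEnd ℂ) (ξ g : ℂ) * (ξ g : ℂ) = 1 := fun g => by
    rw [mul_comm, Complex.mul_conj, Circle.normSq_coe, Complex.ofReal_one]
  have hξadj : ∀ g, adjoint (U g : H →L[ℂ] H) ∘L adjoint W =
      (starRingEnd ℂ) (ξ g : ℂ) • (adjoint W ∘L adjoint (V g : K →L[ℂ] K)) := fun g => by
    rw [← adjoint_comp, hξ, map_smulₛₗ, adjoint_comp]
  have hQU : ∀ g, Q ∘L (U g : H →L[ℂ] H) = (U g : H →L[ℂ] H) ∘L Q := by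
    intro g
    -- The phase cancels against its conjugate, so `W†W`, and with it `Q`, commutes with `U g`.
    have h1 : adjoint (U g : H →L[ℂ] H) ∘L (adjoint W ∘L W) ∘L (U g : H →L[ℂ] H) =
        adjoint W ∘L W := by
      rw [comp_assoc, hξ, ← comp_assoc, hξadj, smul_comp, comp_smul, smul_smul, hξξ, one_smul,
        comp_assoc, ← comp_assoc (adjoint (V g : K →L[ℂ] K)), hVV]
      rfl
    have h2 : (adjoint W ∘L W) ∘L (U g : H →L[ℂ] H) = (U g : H →L[ℂ] H) ∘L (adjoint W ∘L W) := by
      conv_rhs => rw [← h1, ← comp_assoc, hUU']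
      rfl
    rw [hQdef, sub_comp, comp_sub, h2]
    rfl
  have hQU' : ∀ g, adjoint (U g : H →L[ℂ] H) ∘L Q = Q ∘L adjoint (U g : H →L[ℂ] H) := by
    intro g
    have := congrArg adjoint (hQU g)
    rwa [adjoint_comp, adjoint_comp, hQadj] at this
  refine ⟨⟨⟨partialIsometryMap W Q, fun k M hM => partialIsometryMap_map_nonneg W hQadj M hM⟩,
    fun X => trace_partialIsometryMap hWQ X⟩, ?_, ?_⟩
  · intro g X
    change partialIsometryMap W Q ((U g : H →L[ℂ] H) ∘L X ∘L adjoint (U g : H →L[ℂ] H)) =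
      (V g : K →L[ℂ] K) ∘L partialIsometryMap W Q X ∘L adjoint (V g : K →L[ℂ] K)
    have h1 : W ∘L ((U g : H →L[ℂ] H) ∘L X ∘L adjoint (U g : H →L[ℂ] H)) ∘L adjoint W =
        (V g : K →L[ℂ] K) ∘L (W ∘L X ∘L adjoint W) ∘L adjoint (V g : K →L[ℂ] K) := by
      rw [comp_assoc, comp_assoc, hξadj, ← comp_assoc, hξ, comp_smul, comp_smul, smul_comp,
        smul_smul, hξξ, one_smul]
      rfl
    have h2 : LinearMap.trace ℂ H (Q ∘L ((U g : H →L[ℂ] H) ∘L X ∘L adjoint (U g : H →L[ℂ] H)) ∘L Q :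
        H →L[ℂ] H).toLinearMap = LinearMap.trace ℂ H (Q ∘L X ∘L Q : H →L[ℂ] H).toLinearMap := by
      rw [comp_assoc, comp_assoc, hQU', ← comp_assoc, hQU, comp_assoc, trace_comp_comm,
        comp_assoc, comp_assoc, comp_assoc, hUU]
      rfl
    rw [partialIsometryMap_apply, partialIsometryMap_apply, h1, h2, add_comp, comp_add, smul_comp,
      comp_smul]
    congr 2
    exact (hVV' g).symm
  · change partialIsometryMap W Q (pureState ψ) = pureState (W ψ)
    -- `ψ` lies in the initial space of `W`, so the mixed-state term vanishes on it.
    have hQψ : Q ψ = 0 := by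
      rw [hQdef, sub_apply, comp_apply, hψ]
      exact sub_self ψ
    rw [partialIsometryMap_apply, pureState, rankOne_comp, rankOne_comp, hQadj, hQψ,
      adjoint_adjoint, comp_rankOne]
    simp [pureState]

theorem covConvertible_of_charFn_eq (U : UnitaryRep G H) (V : UnitaryRep G K) (ψ : H) {φ : K}
    (hφ : φ ≠ 0) (ξ : G →* Circle) (h : ∀ g, charFn U ψ g = (ξ g : ℂ) * charFn V φ g) :
    CovConvertible U V (pureState ψ) (pureState φ) := by
  have : Nontrivial K := ⟨φ, 0, hφ⟩
  let v : G → H := fun g => (U g : H →L[ℂ] H) ψ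
  -- The phase is absorbed into the second orbit so that the Gram matrices agree.
  let w : G → K := fun g => (ξ g : ℂ) • (V g : K →L[ℂ] K) φ
  obtain ⟨W, hWv, hWW⟩ := exists_partialIsometry_of_inner_eq v w fun g k => by
    simp only [v, w]
    rw [inner_smul_left, inner_smul_right, inner_rep_apply, inner_rep_apply, h, map_mul, map_inv,
      Circle.coe_mul, Circle.coe_inv_eq_conj]
    ring
  have hv1 : v 1 = ψ := rep_one_apply U ψ
  have hw1 : w 1 = φ := by simp [w]
  set S := Submodule.span ℂ (Set.range v) with hS
  have hWψ : W ψ = φ := by rw [← hv1, hWv, hw1]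
  have hvS : ∀ g, v g ∈ S := fun g => Submodule.subset_span ⟨g, rfl⟩
  -- With `P` the projection onto `S` and `y = P x - x`, `‖W y‖² = ⟨y, P y⟩ = 0`.
  have hWS : ∀ x, W (S.starProjection x) = W x := by
    intro x
    have h0 : S.starProjection (S.starProjection x - x) = 0 := by
      rw [map_sub, Submodule.starProjection_eq_self_iff.2 (Submodule.starProjection_apply_mem _ _),
        sub_self]
    rw [← sub_eq_zero, ← map_sub, ← inner_self_eq_zero (𝕜 := ℂ), ← adjoint_inner_right,
      ← comp_apply, hWW, h0, inner_zero_right]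
  have hUS : ∀ g, ∀ x ∈ S, (U g : H →L[ℂ] H) x ∈ S ∧
      W ((U g : H →L[ℂ] H) x) = (ξ g : ℂ) • (V g : K →L[ℂ] K) (W x) := by
    intro g x hx
    induction hx using Submodule.span_induction with
    | mem x hx =>
      obtain ⟨k, rfl⟩ := hx
      have hv : (U g : H →L[ℂ] H) (v k) = v (g * k) := (rep_mul_apply U g k ψ).symm
      rw [hv]
      refine ⟨hvS _, ?_⟩
      rw [hWv, hWv]
      simp only [w]
      rw [map_mul, Circle.coe_mul, rep_mul_apply, map_smul, smul_smul]
    | zero => simp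
    | add x y _ _ hx hy =>
      refine ⟨by rw [map_add]; exact S.add_mem hx.1 hy.1, ?_⟩
      simp only [map_add, hx.2, hy.2, smul_add]
    | smul c x _ hx =>
      refine ⟨by rw [map_smul]; exact S.smul_mem c hx.1, ?_⟩
      simp only [map_smul, hx.2]
      rw [smul_comm]
  -- `S` is invariant under `U g⁻¹ = (U g)†`, hence `Sᗮ` under `U g`.
  have hUSperp : ∀ g, ∀ x ∈ Sᗮ, (U g : H →L[ℂ] H) x ∈ Sᗮ := by
    intro g x hx
    rw [Submodule.mem_orthogonal] at hx ⊢
    intro y hy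
    have hy' := hx _ (hUS g⁻¹ y hy).1
    rw [map_inv] at hy'
    rw [← adjoint_inner_left]
    exact hy'
  have hWperp : ∀ x ∈ Sᗮ, W x = 0 := by
    intro x hx
    rw [← hWS, (Submodule.starProjection_apply_eq_zero_iff S).2 hx, map_zero]
  have hint : ∀ g, W ∘L (U g : H →L[ℂ] H) = (ξ g : ℂ) • ((V g : K →L[ℂ] K) ∘L W) := by
    intro g
    ext x
    have hx : x = S.starProjection x + (x - S.starProjection x) := by abel
    have h1 := (hUS g _ (S.starProjection_apply_mem x)).2
    have h2 := S.sub_starProjection_mem_orthogonal x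
    have h3 := hWperp _ (hUSperp g _ h2)
    simp only [comp_apply, smul_apply]
    rw [hx, map_add, map_add, map_add W, h1, h3, hWperp _ h2, add_zero, add_zero]
  have hψS : adjoint W (W ψ) = ψ := by
    rw [← comp_apply, hWW, Submodule.starProjection_eq_self_iff, ← hv1]
    exact hvS 1
  have := covConvertible_of_partialIsometry U V W
    (hWW ▸ S.isIdempotentElem_starProjection) ξ hint hψS
  rwa [hWψ] at this

end Conversion

/-! ### Necessity: the phase from a pair of covariant operations. -/

section Phase

variable {G H K : Type*} [Group G] [TopologicalSpace G]
  [NormedAddCommGroup H] [InnerProductSpace ℂ H] [CompleteSpace H] [FiniteDimensional ℂ H]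
  [NormedAddCommGroup K] [InnerProductSpace ℂ K] [CompleteSpace K] [FiniteDimensional ℂ K]

/-- If a quantum operation maps the pure states of the vectors `v i` to those of the unit vectors
`w i`, then the Gram matrix of `v` is the Hadamard product of the Gram matrix of `w` with another
Gram matrix. -/
theorem QuantumOperation.exists_gram_factor (E : QuantumOperation H K) {n : Type*} [Fintype n]
    (v : n → H) (w : n → K) (hw : ∀ i, ‖w i‖ = 1)
    (h : ∀ i, E.toLinearMap (pureState (v i)) = pureState (w i)) :
    ∃ b : n → PiLp 2 (fun _ : n => K), ∀ i j,
      inner ℂ (v j) (v i) = inner ℂ (b i) (b j) * inner ℂ (w j) (w i) := by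
  -- `E` is applied entrywise to the positive matrix `(|v i⟩⟨v j|)`. Its off-diagonal entries carry
  -- the inner products, which the traces recover at the end.
  obtain ⟨B, hB⟩ := exists_eq_star_mul_self_of_nonneg
    (E.toCompletelyPositiveMap.map_cstarMatrix_nonneg _ (CStarMatrix.ofMatrix_rankOne_nonneg v))
  have hE : ∀ i j, E.toLinearMap (rankOne ℂ (v i) (v j)) =
      ∑ r, adjoint (B r i) ∘L B r j := by
    intro i j
    have := congrArg (fun M : CStarMatrix n n (K →L[ℂ] K) => M i j) hB
    simp only [CStarMatrix.mul_apply, CStarMatrix.star_apply] at this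
    exact this
  -- The diagonal entry `∑ r, (B r i)† (B r i)` equals `|w i⟩⟨w i|`. It vanishes on the complement
  -- of `w i`, so every summand, being positive, does too.
  have hker : ∀ r i x, inner ℂ (w i) x = 0 → B r i x = 0 := by
    intro r i x hx
    have h1 : (∑ r, ‖B r i x‖ ^ 2 : ℝ) = 0 := by
      have h2 : inner ℂ x (E.toLinearMap (pureState (v i)) x) = 0 := by
        rw [h, pureState, rankOne_apply, hx, zero_smul, inner_zero_right]
      rw [pureState, hE, _root_.sum_apply, inner_sum] at h2
      simp only [comp_apply, adjoint_inner_right, inner_self_eq_norm_sq_to_K] at h2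
      rw [← Complex.ofReal_eq_zero, Complex.ofReal_sum]
      simpa using h2
    have h3 := (Finset.sum_eq_zero_iff_of_nonneg fun r _ => sq_nonneg ‖B r i x‖).1 h1 r
      (Finset.mem_univ r)
    exact norm_eq_zero.1 (pow_eq_zero_iff two_ne_zero |>.1 h3)
  have hrank : ∀ r i, B r i = rankOne ℂ (B r i (w i)) (w i) := fun r i =>
    eq_rankOne_of_apply_eq_zero (hw i) (hker r i)
  refine ⟨fun i => WithLp.toLp 2 fun r => B r i (w i), fun i j => ?_⟩
  rw [PiLp.inner_apply, Finset.sum_mul, ← trace_rankOne, ← E.trace_preserving, hE, toLinearMap_sum,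
    map_sum]
  refine Finset.sum_congr rfl fun r _ => ?_
  conv_lhs => rw [hrank r i, hrank r j]
  rw [adjoint_rankOne, rankOne_comp_rankOne, toLinearMap_smul, map_smul, trace_rankOne, smul_eq_mul]

/-- A covariant conversion of `ψ` to `φ` makes `χ_ψ / χ_φ` a function of positive type. -/
theorem CovConvertible.exists_inner_eq {U : UnitaryRep G H} {V : UnitaryRep G K} {ψ : H} {φ : K}
    (hψ : ‖ψ‖ = 1) (hφ : ‖φ‖ = 1) (hχ : ∀ g, charFn V φ g ≠ 0)
    (h : CovConvertible U V (pureState ψ) (pureState φ)) {n : Type*} [Fintype n] (s : n → G) :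
    ∃ b : n → PiLp 2 (fun _ : n => K), (∀ i, ‖b i‖ = 1) ∧ ∀ i j,
      charFn U ψ ((s j)⁻¹ * s i) / charFn V φ ((s j)⁻¹ * s i) = inner ℂ (b i) (b j) := by
  obtain ⟨E, hcov, hE⟩ := h
  obtain ⟨b, hb⟩ := E.exists_gram_factor (fun i => (U (s i) : H →L[ℂ] H) ψ)
    (fun i => (V (s i) : K →L[ℂ] K) φ) (fun i => by rw [norm_rep_apply, hφ])
    (fun i => by rw [← conj_pureState, hcov, hE, conj_pureState])
  refine ⟨b, fun i => ?_, fun i j => ?_⟩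
  · have h1 := hb i i
    simp only [inner_self_eq_norm_sq_to_K, norm_rep_apply, hψ, hφ] at h1
    have h2 : ‖b i‖ ^ 2 = 1 := by
      rw [← Complex.ofReal_inj]
      simpa using h1.symm
    exact (pow_eq_one_iff_of_nonneg (norm_nonneg _) two_ne_zero).1 h2
  · rw [div_eq_iff (hχ _), ← inner_rep_apply, ← inner_rep_apply, hb]

/-- Cauchy–Schwarz for the Gram vectors at the two points `1, g`. -/
theorem CovConvertible.norm_charFn_le {U : UnitaryRep G H} {V : UnitaryRep G K} {ψ : H} {φ : K}
    (hψ : ‖ψ‖ = 1) (hφ : ‖φ‖ = 1) (hχ : ∀ g, charFn V φ g ≠ 0)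
    (h : CovConvertible U V (pureState ψ) (pureState φ)) (g : G) :
    ‖charFn U ψ g‖ ≤ ‖charFn V φ g‖ := by
  obtain ⟨b, hb1, hb⟩ := h.exists_inner_eq hψ hφ hχ ![1, g]
  have h1 := hb 1 0
  simp only [Matrix.cons_val_zero, Matrix.cons_val_one, inv_one, one_mul] at h1
  have h2 : ‖charFn U ψ g / charFn V φ g‖ ≤ 1 := by
    rw [h1]
    exact (norm_inner_le_norm _ _).trans (by rw [hb1, hb1, one_mul])
  rwa [norm_div, div_le_one (norm_pos_iff.2 (hχ g))] at h2

theorem GEquivalent.exists_phase {U : UnitaryRep G H} {V : UnitaryRep G K} {ψ : H} {φ : K}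
    (hψ : ‖ψ‖ = 1) (hφ : ‖φ‖ = 1) (hχψ : ∀ g, charFn U ψ g ≠ 0) (hχφ : ∀ g, charFn V φ g ≠ 0)
    (h : GEquivalent U V (pureState ψ) (pureState φ)) :
    ∃ ξ : G →ₜ* Circle, ∀ g, charFn U ψ g = (ξ g : ℂ) * charFn V φ g := by
  let f : G → ℂ := fun g => charFn U ψ g / charFn V φ g
  have hnorm : ∀ g, ‖f g‖ = 1 := by
    intro g
    rw [norm_div, div_eq_one_iff_eq (norm_ne_zero_iff.2 (hχφ g))]
    exact le_antisymm (h.1.norm_charFn_le hψ hφ hχφ g) (h.2.norm_charFn_le hφ hψ hχψ g)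
  have hmul : ∀ g k, f (g * k) = f g * f k := by
    intro g k
    -- Among these three points the quotients are `g`, `g * k` and `g⁻¹ * (g * k) = k`. Since `|f g|
    -- = 1`, the vectors `b 0` and `b 1` are parallel.
    obtain ⟨b, hb1, hb⟩ := h.1.exists_inner_eq hψ hφ hχφ ![1, g, g * k]
    have h10 : f g = inner ℂ (b 1) (b 0) := by simpa using hb 1 0
    have h20 : f (g * k) = inner ℂ (b 2) (b 0) := by simpa using hb 2 0
    have h21 : f k = inner ℂ (b 2) (b 1) := by simpa using hb 2 1
    rw [h10, h20, h21]
    refine (inner_mul_inner_of_norm_inner_eq_one (hb1 0) (hb1 1) ?_ _).symm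
    rw [norm_inner_symm, ← h10, hnorm]
  have hcont : Continuous f := (continuous_charFn U ψ).div (continuous_charFn V φ) hχφ
  let ξ : G →* Circle := MonoidHom.mk' (fun g => ⟨f g, mem_sphere_zero_iff_norm.2 (hnorm g)⟩)
    fun g k => Circle.ext (hmul g k)
  refine ⟨⟨ξ, hcont.subtype_mk _⟩, fun g => ?_⟩
  exact (div_mul_cancel₀ _ (hχφ g)).symm

end Phase

theorem mainTheorem3 {G H K : Type*} [Group G] [TopologicalSpace G]
    (hG : IsFiniteOrCompactLieGroup G)
    [NormedAddCommGroup H] [InnerProductSpace ℂ H] [CompleteSpace H] [FiniteDimensional ℂ H]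
    [NormedAddCommGroup K] [InnerProductSpace ℂ K] [CompleteSpace K] [FiniteDimensional ℂ K]
    (U : UnitaryRep G H) (V : UnitaryRep G K)
    (ψ : H) (φ : K) (hψ : ‖ψ‖ = 1) (hφ : ‖φ‖ = 1)
    (hχψ : ∀ g : G, charFn U ψ g ≠ 0) (hχφ : ∀ g : G, charFn V φ g ≠ 0) :
    GEquivalent U V (pureState ψ) (pureState φ) ↔
      ∃ ξ : G →ₜ* Circle, ∀ g : G, charFn U ψ g = (ξ g : ℂ) * charFn V φ g := by
  refine ⟨fun h => h.exists_phase hψ hφ hχψ hχφ, ?_⟩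
  rintro ⟨ξ, h⟩
  have hψ0 : ψ ≠ 0 := norm_ne_zero_iff.1 (by rw [hψ]; exact one_ne_zero)
  have hφ0 : φ ≠ 0 := norm_ne_zero_iff.1 (by rw [hφ]; exact one_ne_zero)
  -- The reverse conversion uses the inverse phase.
  refine ⟨covConvertible_of_charFn_eq U V ψ hφ0 ξ.toMonoidHom h,
    covConvertible_of_charFn_eq V U φ hψ0 (ξ.toMonoidHom)⁻¹ fun g => ?_⟩
  rw [h, MonoidHom.inv_apply, Circle.coe_inv]
  exact (inv_mul_cancel_left₀ (Circle.coe_ne_zero (ξ g)) _).symm
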